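/- Let $\mathbb D=\{z\in\mathbb C:|z|<1\}$, $\mathbb D^*=\{z\in\mathbb C:0<|z|<1\}$, $\Omega=\mathbb D\times\mathbb D^*\subset\mathbb C^2$, and let $1\le p<\infty$. For a $(0,1)$-form $f=f_1\,d\bar z_1+f_2\,d\bar z_2$ on $\Omega$ put $$\mathscr D(f)=\tfrac12\left(\frac{\partial f_1}{\partial\bar z_2}+\frac{\partial f_2}{\partial\bar z_1}\right),$$ with derivatives taken in the sense of distributions on $\Omega$. Let $\mathcal B$ be the space of all $f$ with $f_1,f_2,\mathscr D(f)\in L^p(\Omega)$, with norm $\|f\|_{\mathcal B}=\|f_1\|_{L^p(\Omega)}+\|f_2\|_{L^p(\Omega)}+\|\mathscr D(f)\|_{L^p(\Omega)}$. There is a constant $C>0$ such that the following holds for every $f\in\mathcal B$ that is $\bar\partial$-closed on $\Omega$ in the weak sense, that is, $\partial f_1/\partial\bar z_2=\partial f_2/\partial\bar z_1$ as distributions on $\Omega$. The function $$ \begin{aligned} T(f)(z_1,z_2)={}&\frac{-1}{2\pi i}\int_{\mathbb D^*}\frac{f_2(z_1,\zeta_2)}{\zeta_2-z_2}\,d\bar\zeta_2\wedge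 d\zeta_2+\frac{-1}{2\pi i}\int_{\mathbb D}\frac{f_1(\zeta_1,z_2)}{\zeta_1-z_1}\,d\bar\zeta_1\wedge d\zeta_1\\ &+\frac{-1}{(2\pi i)^2}\int_{\mathbb D\times\mathbb D^*}\frac{\mathscr D(f)(\zeta_1,\zeta_2)}{(\zeta_1-z_1)(\zeta_2-z_2)}\,d\bar\zeta_1\wedge d\zeta_1\wedge d\bar\zeta_2\wedge d\zeta_2 \end{aligned} $$ is well defined: the three integrals converge absolutely for almost every $(z_1,z_2)\in\Omega$, and changing $f_1,f_2$ on null sets changes $T(f)$ only on a null set. Moreover $T(f)\in L^p(\Omega)$, $T(f)$ is a weak solution of $\bar\partial(Tf)=f$ on $\Omega$, that is, $\partial T(f)/\partial\bar z_j=f_j$ ($j=1,2$) as distributions on $\Omega$, and $$\|T(f)\|_{L^p(\Omega)}\le C\,\|f\|_{\mathcal B}.$$ -/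

import Mathlib

open MeasureTheory Set
open scoped ENNReal ContDiff

noncomputable section

namespace DbarProduct

/-- The unit disc `𝔻 = {|z| < 1}`. -/
def disc : Set ℂ := {z | ‖z‖ < 1}

/-- The punctured unit disc `𝔻* = {0 < |z| < 1}`. -/
def puncturedDisc : Set ℂ := {z | 0 < ‖z‖ ∧ ‖z‖ < 1}

/-- A `(0,1)`-form `f = f₁ dz̄₁ + f₂ dz̄₂` in two complex variables, given by its coefficient
functions. Only the values of the coefficients on the domain under consideration matter. -/
structure Form01 where
  /-- the coefficient of `dz̄₁` -/
  f₁ : ℂ × ℂ → ℂ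
  /-- the coefficient of `dz̄₂` -/
  f₂ : ℂ × ℂ → ℂ

/-- Test functions on `Ω`: complex valued, smooth, with compact support contained in `Ω`. -/
def IsTestFunction (Ω : Set (ℂ × ℂ)) (φ : ℂ × ℂ → ℂ) : Prop :=
  ContDiff ℝ ∞ φ ∧ HasCompactSupport φ ∧ tsupport φ ⊆ Ω

/-- The Wirtinger derivative `∂φ/∂z̄₁ = (∂φ/∂x₁ + i ∂φ/∂y₁) / 2`. -/
def dbar₁ (φ : ℂ × ℂ → ℂ) (z : ℂ × ℂ) : ℂ :=
  (fderiv ℝ φ z (1, 0) + Complex.I * fderiv ℝ φ z (Complex.I, 0)) / 2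

/-- The Wirtinger derivative `∂φ/∂z̄₂ = (∂φ/∂x₂ + i ∂φ/∂y₂) / 2`. -/
def dbar₂ (φ : ℂ × ℂ → ℂ) (z : ℂ × ℂ) : ℂ :=
  (fderiv ℝ φ z (0, 1) + Complex.I * fderiv ℝ φ z (0, Complex.I)) / 2

/-- Both coefficients of `f` are locally integrable on `Ω` (so that `f` defines distributions). -/
def Form01.LocIntegrableOn (f : Form01) (Ω : Set (ℂ × ℂ)) : Prop :=
  LocallyIntegrableOn f.f₁ Ω ∧ LocallyIntegrableOn f.f₂ Ω

/-- `f` is `∂̄`-closed on `Ω` in the weak sense: `∂f₁/∂z̄₂ = ∂f₂/∂z̄₁` as distributions on `Ω`. -/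
def IsWeaklyDbarClosed (Ω : Set (ℂ × ℂ)) (f : Form01) : Prop :=
  f.LocIntegrableOn Ω ∧ ∀ φ : ℂ × ℂ → ℂ, IsTestFunction Ω φ →
    ∫ z in Ω, f.f₁ z * dbar₂ φ z = ∫ z in Ω, f.f₂ z * dbar₁ φ z

/-- `u` is a weak solution of `∂̄u = f` on `Ω`: `∂u/∂z̄₁ = f₁` and `∂u/∂z̄₂ = f₂` as distributions
on `Ω`. -/
def IsWeakDbarSolution (Ω : Set (ℂ × ℂ)) (u : ℂ × ℂ → ℂ) (f : Form01) : Prop :=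
  LocallyIntegrableOn u Ω ∧ f.LocIntegrableOn Ω ∧ ∀ φ : ℂ × ℂ → ℂ, IsTestFunction Ω φ →
    ∫ z in Ω, u z * dbar₁ φ z = -∫ z in Ω, f.f₁ z * φ z ∧
    ∫ z in Ω, u z * dbar₂ φ z = -∫ z in Ω, f.f₂ z * φ z

/-- The distribution `𝒟(f) = (∂f₁/∂z̄₂ + ∂f₂/∂z̄₁) / 2` on `Ω` is given by the locally integrable
function `g`. -/
def IsScriptD (Ω : Set (ℂ × ℂ)) (f : Form01) (g : ℂ × ℂ → ℂ) : Prop :=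
  f.LocIntegrableOn Ω ∧ LocallyIntegrableOn g Ω ∧ ∀ φ : ℂ × ℂ → ℂ, IsTestFunction Ω φ →
    ∫ z in Ω, g z * φ z =
      -((∫ z in Ω, f.f₁ z * dbar₂ φ z) + ∫ z in Ω, f.f₂ z * dbar₁ φ z) / 2

open scoped Classical in
/-- A function representing the distribution `𝒟(f)` on `Ω`, if there is one (and `0` otherwise).
It is determined up to equality almost everywhere on `Ω`, see `IsScriptD.ae_eq`. -/
def scriptD (Ω : Set (ℂ × ℂ)) (f : Form01) : ℂ × ℂ → ℂ :=
  if h : ∃ g, IsScriptD Ω f g then h.choose else 0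

theorem isScriptD_scriptD {Ω : Set (ℂ × ℂ)} {f : Form01} (h : ∃ g, IsScriptD Ω f g) :
    IsScriptD Ω f (scriptD Ω f) := by
  rw [scriptD, dif_pos h]
  exact h.choose_spec

/-- Two functions representing `𝒟(f)` on the open set `Ω` agree almost everywhere on `Ω`. -/
theorem IsScriptD.ae_eq {Ω : Set (ℂ × ℂ)} (hΩ : IsOpen Ω) {f : Form01} {g h : ℂ × ℂ → ℂ}
    (hg : IsScriptD Ω f g) (hh : IsScriptD Ω f h) : g =ᵐ[volume.restrict Ω] h := by
  have key : ∀ᵐ z, z ∈ Ω → (g - h) z = 0 := by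
    refine hΩ.ae_eq_zero_of_integral_contDiff_smul_eq_zero (hg.2.1.sub hh.2.1) ?_
    intro φ hφ hc hs
    have hsupp : Function.support (fun z => (φ z : ℂ)) = Function.support φ := by
      ext z; simp
    have hts : tsupport (fun z => (φ z : ℂ)) = tsupport φ := by simp only [tsupport, hsupp]
    have ht : IsTestFunction Ω (fun z => (φ z : ℂ)) :=
      ⟨Complex.ofRealCLM.contDiff.comp hφ, by rw [HasCompactSupport, hts]; exact hc, hts ▸ hs⟩
    have hint : ∀ k : ℂ × ℂ → ℂ, LocallyIntegrableOn k Ω →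
        IntegrableOn (fun z => k z * (φ z : ℂ)) Ω := by
      intro k hk
      have h1 : IntegrableOn (fun z => k z * (φ z : ℂ)) (tsupport φ) :=
        (hk.integrableOn_compact_subset hs hc).mul_continuousOn
          (Complex.continuous_ofReal.comp hφ.continuous).continuousOn hc
      have h2 : Integrable (fun z => k z * (φ z : ℂ)) := by
        rwa [integrableOn_iff_integrable_of_support_subset] at h1
        intro z hz
        apply subset_tsupport
        intro h0
        exact hz (by simp [h0])
      exact h2.integrableOn
    have hzero : ∀ z, z ∉ Ω → φ z • (g - h) z = 0 := by
      intro z hz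
      have : φ z = 0 := image_eq_zero_of_notMem_tsupport fun h' => hz (hs h')
      simp [this]
    rw [← setIntegral_eq_integral_of_forall_compl_eq_zero hzero]
    calc ∫ z in Ω, φ z • (g - h) z = ∫ z in Ω, (g z * (φ z : ℂ) - h z * (φ z : ℂ)) := by
          congr 1; ext z; simp [Complex.real_smul]; ring
      _ = 0 := by
          rw [integral_sub (hint g hg.2.1) (hint h hh.2.1), hg.2.2 _ ht, hh.2.2 _ ht, sub_self]
  rw [Filter.EventuallyEq, ae_restrict_iff' hΩ.measurableSet]
  filter_upwards [key] with z hz hzΩ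
  exact sub_eq_zero.mp (hz hzΩ)

/-- Membership in the space `𝓑` on `Ω`: `f₁, f₂ ∈ Lᵖ(Ω)` and `𝒟(f) ∈ Lᵖ(Ω)`. -/
def MemB (p : ℝ≥0∞) (Ω : Set (ℂ × ℂ)) (f : Form01) : Prop :=
  MemLp f.f₁ p (volume.restrict Ω) ∧ MemLp f.f₂ p (volume.restrict Ω) ∧
    ∃ g, IsScriptD Ω f g ∧ MemLp g p (volume.restrict Ω)

/-- The norm `‖f‖_𝓑 = ‖f₁‖_{Lᵖ(Ω)} + ‖f₂‖_{Lᵖ(Ω)} + ‖𝒟(f)‖_{Lᵖ(Ω)}`; it is finite on `𝓑`. -/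
def normB (p : ℝ≥0∞) (Ω : Set (ℂ × ℂ)) (f : Form01) : ℝ≥0∞ :=
  eLpNorm f.f₁ p (volume.restrict Ω) + eLpNorm f.f₂ p (volume.restrict Ω) +
    eLpNorm (scriptD Ω f) p (volume.restrict Ω)

/-- The operator `T` on `D₁ × D₂`. With `dA` Lebesgue measure on `ℂ` we have `dζ̄ ∧ dζ = 2i dA`,
which accounts for the factors `2i` and `(2i)²`. -/
def solT (D₁ D₂ : Set ℂ) (f : Form01) (z : ℂ × ℂ) : ℂ :=
  -1 / (2 * Real.pi * Complex.I) *
      ((2 * Complex.I) * ∫ ζ in D₂, f.f₂ (z.1, ζ) / (ζ - z.2)) +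
    -1 / (2 * Real.pi * Complex.I) *
      ((2 * Complex.I) * ∫ ζ in D₁, f.f₁ (ζ, z.2) / (ζ - z.1)) +
    -1 / (2 * Real.pi * Complex.I) ^ 2 *
      ((2 * Complex.I) ^ 2 *
        ∫ ζ in D₁ ×ˢ D₂, scriptD (D₁ ×ˢ D₂) f ζ / ((ζ.1 - z.1) * (ζ.2 - z.2)))

/-- The three integrals in the formula for `Tf` at the point `z` converge absolutely. -/
def SolTConvergesAt (D₁ D₂ : Set ℂ) (f : Form01) (z : ℂ × ℂ) : Prop :=
  IntegrableOn (fun ζ : ℂ => f.f₂ (z.1, ζ) / (ζ - z.2)) D₂ ∧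
    IntegrableOn (fun ζ : ℂ => f.f₁ (ζ, z.2) / (ζ - z.1)) D₁ ∧
    IntegrableOn (fun ζ : ℂ × ℂ =>
      scriptD (D₁ ×ˢ D₂) f ζ / ((ζ.1 - z.1) * (ζ.2 - z.2))) (D₁ ×ˢ D₂)

end DbarProduct

end

namespace DbarProduct

open Metric Real

/-! Write `C₁`, `C₂` for the partial Cauchy transforms with kernel `1 / (ζ - z)` in the first and
second variable, and `G` for `𝒟(f)`. Up to null sets the operator is `Tf = -(1/π) (C₂ f₂ + C₁ f₁ +
(1/π) C₁ C₂ G)`. Closedness makes the two halves of `𝒟(f)` equal, so `G = ∂f₂/∂z̄₁ = ∂f₁/∂z̄₂`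
weakly.

Two facts give the equation. By Cauchy–Pompeiu, `∂/∂z̄₁` of `C₁ F` is `-π F`
(`integral_cauchyFst_mul_dbar₁`). Moreover `C₂` commutes with weak `∂/∂z̄₁`
(`integral_cauchySnd_mul_dbar₁`). Hence `∂(Tf)/∂z̄₁ = -(1/π) (C₂ G - π f₁ - C₂ G) = f₁`, and
exchanging the variables gives the other equation. Both facts are proved by moving the transform
onto a test function, whose compact support in `Ω` removes all boundary terms.

For the norm, `1 / |ζ - z|` has mass at most a constant `A` over the disc, uniformly in `z`
(`lintegral_enorm_inv_sub_le`). By Jensen and Tonelli each transform then has norm at most `A` on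
`Lᵖ` (`eLpNorm_cauchyFst_le`), so `T` is bounded with constant `A + A²`. The same mass bound gives
absolute convergence almost everywhere. The argument needs only open factors of finite area with
bounded kernel mass, so the puncture does no harm. -/

/-! ### Mass of the Cauchy kernel. -/

lemma lintegral_ball_enorm_inv_lt_top : ∫⁻ w in ball (0 : ℂ) 1, ‖w⁻¹‖ₑ < ⊤ := by
  rw [← lintegral_indicator measurableSet_ball, ← Complex.lintegral_comp_polarCoord_symm]
  -- The polar Jacobian `r` cancels the singularity `1 / r` and leaves the indicator of a bounded
  -- rectangle.
  calc _ ≤ ∫⁻ q in polarCoord.target, (Ioo (0 : ℝ) 1 ×ˢ Ioo (-π) π).indicator 1 q := by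
        refine setLIntegral_mono' polarCoord.open_target.measurableSet fun q hq => ?_
        have hq' : 0 < q.1 ∧ q.2 ∈ Ioo (-π) π := hq
        have hn : ‖Complex.polarCoord.symm q‖ = q.1 := by
          rw [Complex.norm_polarCoord_symm, abs_of_pos hq'.1]
        by_cases h1 : q.1 < 1
        · have hm : q ∈ Ioo (0 : ℝ) 1 ×ˢ Ioo (-π) π := ⟨⟨hq'.1, h1⟩, hq'.2⟩
          rw [indicator_of_mem hm, indicator_of_mem (by simpa only [mem_ball_zero_iff, hn] using h1), smul_eq_mul,
            ← ofReal_norm, ← ENNReal.ofReal_mul hq'.1.le, norm_inv, hn,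
            mul_inv_cancel₀ hq'.1.ne']
          simp
        · rw [indicator_of_notMem (by simpa only [mem_ball_zero_iff, hn] using h1)]
          simp
    _ ≤ ∫⁻ q, (Ioo (0 : ℝ) 1 ×ˢ Ioo (-π) π).indicator 1 q := setLIntegral_le_lintegral _ _
    _ = volume (Ioo (0 : ℝ) 1 ×ˢ Ioo (-π) π) :=
        lintegral_indicator_one (measurableSet_Ioo.prod measurableSet_Ioo)
    _ < ⊤ := by
        rw [Measure.volume_eq_prod, Measure.prod_prod]
        simp

/-- A bound for the mass of the kernel `1 / |ζ - z|` over subsets of the unit disc. -/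
noncomputable def cauchyMass : ℝ≥0∞ :=
  (∫⁻ w in ball (0 : ℂ) 1, ‖w⁻¹‖ₑ) + volume (ball (0 : ℂ) 1)

lemma cauchyMass_lt_top : cauchyMass < ⊤ :=
  ENNReal.add_lt_top.2 ⟨lintegral_ball_enorm_inv_lt_top, measure_ball_lt_top⟩

lemma lintegral_enorm_inv_sub_le {D : Set ℂ} (hD : D ⊆ ball 0 1) (z : ℂ) :
    ∫⁻ ζ in D, ‖(ζ - z)⁻¹‖ₑ ≤ cauchyMass := by
  -- Within distance 1 of `z` the kernel is a translate of the one at the origin; farther away it is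
  -- at most 1. This makes the bound uniform in `z`.
  have h1 : ∀ ζ : ℂ, ‖(ζ - z)⁻¹‖ₑ ≤ (ball z 1).indicator (fun ζ => ‖(ζ - z)⁻¹‖ₑ) ζ + 1 := by
    intro ζ
    by_cases h : ζ ∈ ball z 1
    · simp [h]
    · rw [indicator_of_notMem h, zero_add, ← ofReal_norm, ENNReal.ofReal_le_one, norm_inv]
      rw [mem_ball, dist_eq_norm, not_lt] at h
      exact inv_le_one_of_one_le₀ h
  calc ∫⁻ ζ in D, ‖(ζ - z)⁻¹‖ₑ ≤ ∫⁻ ζ in ball 0 1, ‖(ζ - z)⁻¹‖ₑ := lintegral_mono_set hD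
    _ ≤ ∫⁻ ζ in ball 0 1, ((ball z 1).indicator (fun ζ => ‖(ζ - z)⁻¹‖ₑ) ζ + 1) :=
        lintegral_mono h1
    _ = (∫⁻ ζ in ball 0 1, (ball z 1).indicator (fun ζ => ‖(ζ - z)⁻¹‖ₑ) ζ)
          + volume (ball (0 : ℂ) 1) := by
        rw [lintegral_add_right _ measurable_const]; simp
    _ ≤ (∫⁻ ζ, (ball z 1).indicator (fun ζ => ‖(ζ - z)⁻¹‖ₑ) ζ) + volume (ball (0 : ℂ) 1) := by
        exact add_le_add (setLIntegral_le_lintegral _ _) le_rfl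
    _ = cauchyMass := by
        rw [cauchyMass, ← lintegral_indicator measurableSet_ball]
        congr 1
        rw [← lintegral_sub_right_eq_self ((ball (0 : ℂ) 1).indicator fun w => ‖w⁻¹‖ₑ) z]
        refine lintegral_congr fun ζ => ?_
        simp only [indicator, mem_ball, dist_eq_norm, sub_zero]

/-! ### The Cauchy–Pompeiu formula. -/

/-- The Cauchy–Pompeiu formula at the origin, for compactly supported functions. -/
lemma integral_dbar_div_self {φ : ℂ → ℂ} (hφ : ContDiff ℝ 1 φ) (hc : HasCompactSupport φ) :
    ∫ z, ((fderiv ℝ φ z 1 + Complex.I * fderiv ℝ φ z Complex.I) / 2) / z = -(π * φ 0) := by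
  obtain ⟨R, hR⟩ : ∃ R : ℝ, tsupport φ ⊆ ball 0 R := hc.isBounded.subset_ball 0
  have hfz : ∀ z : ℂ, R ≤ ‖z‖ → φ z = 0 ∧ fderiv ℝ φ z = 0 := by
    intro z hz
    have hzs : z ∉ tsupport φ := fun h => by
      have := hR h
      rw [mem_ball_zero_iff] at this
      exact absurd this (not_lt.2 hz)
    exact ⟨image_eq_zero_of_notMem_tsupport hzs,
      image_eq_zero_of_notMem_tsupport fun h => hzs (tsupport_fderiv_subset ℝ h)⟩
  set e : ℝ → ℂ := fun θ => Complex.exp (θ * Complex.I) with he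
  have hecont : Continuous e := by fun_prop
  have hnorm : ∀ θ, ‖e θ‖ = 1 := fun θ => Complex.norm_exp_ofReal_mul_I θ
  set S : Set (ℝ × ℝ) := Ioi (0 : ℝ) ×ˢ Ioo (-π) π with hS
  have hSm : MeasurableSet S := measurableSet_Ioi.prod measurableSet_Ioo
  have hDcont : Continuous (fderiv ℝ φ) := hφ.continuous_fderiv one_ne_zero
  -- In polar coordinates `g₁` is `∂φ/∂r` and `g₂` is `(1/r) ∂φ/∂θ`.
  set g₁ : ℝ × ℝ → ℂ := fun q => fderiv ℝ φ (q.1 * e q.2) (e q.2) with hg₁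
  set g₂ : ℝ × ℝ → ℂ := fun q => fderiv ℝ φ (q.1 * e q.2) (Complex.I * e q.2) with hg₂
  have hc₁ : Continuous g₁ := (hDcont.comp (by fun_prop)).clm_apply (by fun_prop)
  have hc₂ : Continuous g₂ := (hDcont.comp (by fun_prop)).clm_apply (by fun_prop)
  have hint : ∀ g : ℝ × ℝ → ℂ, Continuous g → (∀ q : ℝ × ℝ, R ≤ q.1 → 0 < q.1 → g q = 0) →
      IntegrableOn g S := by
    intro g hg h0
    have : IntegrableOn g (Icc (0 : ℝ) R ×ˢ Icc (-π) π) :=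
      hg.continuousOn.integrableOn_compact (isCompact_Icc.prod isCompact_Icc)
    refine this.of_forall_sdiff_eq_zero hSm ?_
    rintro q ⟨hq, hq'⟩
    refine h0 q ?_ hq.1
    by_contra hlt
    exact hq' ⟨⟨le_of_lt hq.1, (not_le.1 hlt).le⟩, Ioo_subset_Icc_self hq.2⟩
  have hnq : ∀ q : ℝ × ℝ, R ≤ q.1 → 0 < q.1 → R ≤ ‖(q.1 * e q.2 : ℂ)‖ := by
    intro q h1 h2
    rw [norm_mul, hnorm, mul_one, Complex.norm_real, Real.norm_of_nonneg h2.le]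
    exact h1
  have hi₁ : IntegrableOn g₁ S := hint g₁ hc₁ fun q h1 h2 => by
    simp [hg₁, (hfz _ (hnq q h1 h2)).2]
  have hi₂ : IntegrableOn g₂ S := hint g₂ hc₂ fun q h1 h2 => by
    simp [hg₂, (hfz _ (hnq q h1 h2)).2]
  have hder : ∀ z, HasFDerivAt φ (fderiv ℝ φ z) z := fun z =>
    (hφ.differentiable one_ne_zero z).hasFDerivAt
  -- Fundamental theorem of calculus along a ray: `φ` vanishes far out, so only the value at the
  -- origin survives.
  have hr : ∀ θ : ℝ, ∫ r in Ioi (0 : ℝ), g₁ (r, θ) = -φ 0 := by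
    intro θ
    have hd : ∀ r : ℝ, HasDerivAt (fun r : ℝ => φ (r * e θ)) (g₁ (r, θ)) r := fun r => by
      have h1 : HasDerivAt (fun r : ℝ => (r * e θ : ℂ)) (e θ) r := by
        simpa using (Complex.ofRealCLM.hasDerivAt (x := r)).mul_const (e θ)
      exact (hder (r * e θ)).comp_hasDerivAt r h1
    have hev : (fun r : ℝ => φ (r * e θ)) =ᶠ[Filter.atTop] fun _ => 0 := by
      filter_upwards [Filter.eventually_ge_atTop R, Filter.eventually_gt_atTop 0] with r h1 h2
      exact (hfz _ (hnq (r, θ) h1 h2)).1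
    have hii : IntegrableOn (fun r => g₁ (r, θ)) (Ioi 0) := by
      have : IntegrableOn (fun r => g₁ (r, θ)) (Icc 0 R) :=
        (hc₁.comp (by fun_prop)).continuousOn.integrableOn_compact isCompact_Icc
      refine this.of_forall_sdiff_eq_zero measurableSet_Ioi ?_
      rintro r ⟨hq, hq'⟩
      have hRr : R ≤ r := by
        by_contra hlt
        exact hq' ⟨le_of_lt hq, (not_le.1 hlt).le⟩
      simp [hg₁, (hfz _ (hnq (r, θ) hRr hq)).2]
    rw [integral_Ioi_of_hasDerivAt_of_tendsto' (fun r _ => hd r) hii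
      (tendsto_const_nhds.congr' hev.symm)]
    simp
  -- `r g₂` is the derivative of a `2π`-periodic function of `θ`, so its integral over a full period
  -- vanishes.
  have hθ : ∀ r ∈ Ioi (0 : ℝ), ∫ θ in Ioo (-π) π, g₂ (r, θ) = 0 := by
    intro r hr0
    have hd : ∀ θ : ℝ, HasDerivAt (fun θ : ℝ => φ (r * e θ)) (r * g₂ (r, θ)) θ := fun θ => by
      have h1 : HasDerivAt (fun θ : ℝ => (r * e θ : ℂ)) (r * (e θ * Complex.I)) θ := by
        have h2 : HasDerivAt (fun θ : ℝ => (θ * Complex.I : ℂ)) Complex.I θ := by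
          simpa using (Complex.ofRealCLM.hasDerivAt (x := θ)).mul_const Complex.I
        exact (h2.cexp).const_mul _
      have h3 := (hder (r * e θ)).comp_hasDerivAt θ h1
      rwa [show (r : ℂ) * (e θ * Complex.I) = r • (Complex.I * e θ) by
        rw [Complex.real_smul]; ring, map_smul, Complex.real_smul] at h3
    have h4 := intervalIntegral.integral_eq_sub_of_hasDerivAt (a := -π) (b := π)
      (fun θ _ => hd θ) ((by fun_prop : Continuous fun θ => (r : ℂ) * g₂ (r, θ)).intervalIntegrable _ _)
    have hee : e π = e (-π) := by
      simp only [he]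
      rw [Complex.exp_eq_exp_iff_exists_int]
      exact ⟨1, by push_cast; ring⟩
    rw [hee, sub_self, intervalIntegral.integral_const_mul, mul_eq_zero] at h4
    rw [← integral_Ioc_eq_integral_Ioo,
      ← intervalIntegral.integral_of_le (by linarith [pi_pos])]
    exact h4.resolve_left (by exact_mod_cast (ne_of_gt hr0))
  have hI₁ : ∫ q in S, g₁ q = -(2 * π * φ 0) := by
    rw [hS, Measure.volume_eq_prod, ← setIntegral_prod_swap, setIntegral_prod]
    · simp only [Prod.swap_prod_mk]
      simp_rw [hr]
      rw [setIntegral_const, measureReal_def, Real.volume_Ioo, ENNReal.toReal_ofReal (by linarith [pi_pos]),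
        Complex.real_smul]
      push_cast; ring
    · exact hi₁.swap
  have hI₂ : ∫ q in S, g₂ q = 0 := by
    rw [hS, Measure.volume_eq_prod, setIntegral_prod _ hi₂]
    rw [setIntegral_congr_fun measurableSet_Ioi hθ]
    simp
  rw [← Complex.integral_comp_polarCoord_symm]
  -- This is `e^{-iθ} (∂/∂x + i ∂/∂y) = ∂/∂r + (i/r) ∂/∂θ`; the Jacobian cancels the modulus of the
  -- denominator.
  have key : ∫ q in polarCoord.target, q.1 • (((fderiv ℝ φ (Complex.polarCoord.symm q) 1
      + Complex.I * fderiv ℝ φ (Complex.polarCoord.symm q) Complex.I) / 2)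
        / (Complex.polarCoord.symm q)) = ∫ q in S, (1 / 2 : ℂ) * (g₁ q + Complex.I * g₂ q) := by
    refine setIntegral_congr_fun hSm fun q hq => ?_
    have hq1 : (q.1 : ℂ) ≠ 0 := by exact_mod_cast (ne_of_gt hq.1)
    have hsy : Complex.polarCoord.symm q = q.1 * e q.2 := by
      rw [Complex.polarCoord_symm_apply, he]
      simp only [Complex.exp_mul_I, Complex.ofReal_cos, Complex.ofReal_sin]
    simp only [hsy, hg₁, hg₂, Complex.real_smul]
    set L := fderiv ℝ φ (q.1 * e q.2)
    have h5 : e q.2 = (Real.cos q.2 : ℝ) • (1 : ℂ) + (Real.sin q.2 : ℝ) • Complex.I := by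
      simp [he, Complex.exp_mul_I, Complex.real_smul]
    have h6 : Complex.I * e q.2 = (-Real.sin q.2 : ℝ) • (1 : ℂ) + (Real.cos q.2 : ℝ) • Complex.I := by
      rw [h5]; simp only [Complex.real_smul, Complex.ofReal_neg]
      linear_combination (Real.sin q.2 : ℂ) * Complex.I_mul_I
    have h7 : L (e q.2) = Real.cos q.2 * L 1 + Real.sin q.2 * L Complex.I := by
      rw [h5, map_add, map_smul, map_smul, Complex.real_smul, Complex.real_smul]
    have h8 : L (Complex.I * e q.2) = -Real.sin q.2 * L 1 + Real.cos q.2 * L Complex.I := by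
      rw [h6, map_add, map_smul, map_smul, Complex.real_smul, Complex.real_smul]; push_cast; rfl
    have h9 : e q.2 ≠ 0 := Complex.exp_ne_zero _
    have h10 : e q.2 = Real.cos q.2 + Real.sin q.2 * Complex.I := by
      rw [h5]; simp [Complex.real_smul]
    have h11 : (Real.cos q.2 : ℂ) ^ 2 + (Real.sin q.2 : ℂ) ^ 2 = 1 := by
      exact_mod_cast Real.cos_sq_add_sin_sq q.2
    rw [h7, h8]
    field_simp
    rw [h10]
    generalize (Real.cos q.2 : ℂ) = c at *
    generalize (Real.sin q.2 : ℂ) = s at *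
    generalize L 1 = a
    generalize L Complex.I = b
    linear_combination (-(a + Complex.I * b)) * h11 - (s * c * b - s ^ 2 * a) * Complex.I_sq
  rw [key, integral_const_mul, integral_add hi₁ (hi₂.const_mul _), integral_const_mul, hI₁, hI₂]
  ring

/-- The Cauchy–Pompeiu formula for compactly supported functions. -/
lemma integral_dbar_div_sub {φ : ℂ → ℂ} (hφ : ContDiff ℝ 1 φ) (hc : HasCompactSupport φ) (w : ℂ) :
    ∫ z, ((fderiv ℝ φ z 1 + Complex.I * fderiv ℝ φ z Complex.I) / 2) / (w - z) = π * φ w := by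
  have h := integral_dbar_div_self (φ := fun z => φ (z + w)) (hφ.comp (by fun_prop))
    (hc.comp_homeomorph (Homeomorph.addRight w))
  simp only [fderiv_comp_add_right, zero_add] at h
  rw [← integral_add_right_eq_self _ w, ← neg_neg (π * φ w : ℂ), ← h, ← integral_neg]
  refine integral_congr_ae (.of_forall fun z => ?_)
  simp only [show w - (z + w) = -z by ring, div_neg]

/-! ### Partial Cauchy transforms: bounds, measurability and Fubini. -/

/-- A weighted Jensen inequality for lower Lebesgue integrals. -/
lemma lintegral_mul_rpow_le {α : Type*} [MeasurableSpace α] {μ : Measure α} {g k : α → ℝ≥0∞}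
    (hg : AEMeasurable g μ) (hk : AEMeasurable k μ) {q : ℝ} (hq : 1 ≤ q) :
    (∫⁻ a, g a * k a ∂μ) ^ q ≤ (∫⁻ a, k a ∂μ) ^ (q - 1) * ∫⁻ a, g a ^ q * k a ∂μ := by
  have hq0 : 0 < q := by linarith
  -- Hölder for `k` and `g ^ q * k` with weights `1 - 1/q` and `1/q`. The weight 0 is allowed, which
  -- covers `q = 1`.
  have h := ENNReal.lintegral_mul_norm_pow_le hk ((hg.pow_const q).mul hk)
    (p := 1 - 1 / q) (q := 1 / q) (by rw [sub_nonneg, div_le_one hq0]; exact hq) (by positivity)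
    (by ring)
  have h1 : ∀ a, k a ^ (1 - 1 / q) * (g a ^ q * k a) ^ (1 / q) = g a * k a := by
    intro a
    rw [ENNReal.mul_rpow_of_nonneg _ _ (by positivity), ← ENNReal.rpow_mul,
      mul_one_div_cancel hq0.ne', ENNReal.rpow_one, mul_left_comm,
      ← ENNReal.rpow_add_of_nonneg _ _ (by rw [sub_nonneg, div_le_one hq0]; exact hq)
        (by positivity)]
    simp
  simp only [Pi.mul_apply, h1] at h
  calc (∫⁻ a, g a * k a ∂μ) ^ q
      ≤ ((∫⁻ a, k a ∂μ) ^ (1 - 1 / q) * (∫⁻ a, g a ^ q * k a ∂μ) ^ (1 / q)) ^ q := by gcongr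
    _ = _ := by
      rw [ENNReal.mul_rpow_of_nonneg _ _ hq0.le, ← ENNReal.rpow_mul, ← ENNReal.rpow_mul,
        one_div_mul_cancel hq0.ne', ENNReal.rpow_one, sub_mul, one_mul,
        one_div_mul_cancel hq0.ne']

/-- The Cauchy transform in the first variable. -/
noncomputable def cauchyFst (μ : Measure ℂ) (F : ℂ × ℂ → ℂ) (z : ℂ × ℂ) : ℂ :=
  ∫ ζ, F (ζ, z.2) / (ζ - z.1) ∂μ

/-- The Cauchy transform in the second variable. -/
noncomputable def cauchySnd (ν : Measure ℂ) (F : ℂ × ℂ → ℂ) (z : ℂ × ℂ) : ℂ :=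
  ∫ ζ, F (z.1, ζ) / (ζ - z.2) ∂ν

/-- The Cauchy kernel has mass at most `A` with respect to `μ`. -/
def CauchyMassLE (μ : Measure ℂ) (A : ℝ≥0∞) : Prop :=
  ∀ z, ∫⁻ ζ, ‖(ζ - z)⁻¹‖ₑ ∂μ ≤ A

lemma CauchyMassLE.lintegral_le {μ : Measure ℂ} {A : ℝ≥0∞} (h : CauchyMassLE μ A) (ζ : ℂ) :
    ∫⁻ z, ‖(ζ - z)⁻¹‖ₑ ∂μ ≤ A := by
  refine le_of_eq_of_le (lintegral_congr fun z => ?_) (h ζ)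
  rw [← neg_sub, inv_neg, enorm_neg]

section

variable {μ ν : Measure ℂ} [SFinite μ] [SFinite ν] {A : ℝ≥0∞} {F G : ℂ × ℂ → ℂ}

/-- Exchanging the evaluation point `z₁` with the integration variable `ζ`, with `z₂` fixed, turns
the transform into its transpose. Every Tonelli and Fubini argument for `cauchyFst` rests on this.
-/
lemma measurePreserving_exchange (μ ν : Measure ℂ) [SFinite μ] [SFinite ν] :
    MeasurePreserving (fun q : (ℂ × ℂ) × ℂ => ((q.2, q.1.2), q.1.1))
      ((μ.prod ν).prod μ) ((μ.prod ν).prod μ) :=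
  (((Measure.measurePreserving_swap (μ := ν) (ν := μ)).prod (MeasurePreserving.id μ)).comp
    (Measure.measurePreserving_swap (μ := μ) (ν := ν.prod μ))).comp
    (measurePreserving_prodAssoc μ ν μ)

lemma quasiMeasurePreserving_source (μ ν : Measure ℂ) [SFinite μ] [SFinite ν] :
    Measure.QuasiMeasurePreserving (fun q : (ℂ × ℂ) × ℂ => (q.2, q.1.2))
      ((μ.prod ν).prod μ) (μ.prod ν) :=
  Measure.quasiMeasurePreserving_fst.comp (measurePreserving_exchange μ ν).quasiMeasurePreserving

/-- After the exchange the kernel is integrated in the evaluation point alone, where its mass is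
again at most `A` because `|ζ - z|` is symmetric. -/
lemma lintegral_lintegral_cauchyFst_le (hA : CauchyMassLE μ A) {h : ℂ × ℂ → ℝ≥0∞}
    (hh : AEMeasurable h (μ.prod ν)) :
    ∫⁻ q, h (q.2, q.1.2) * ‖(q.2 - q.1.1)⁻¹‖ₑ ∂((μ.prod ν).prod μ)
      ≤ A * ∫⁻ w, h w ∂(μ.prod ν) := by
  have hm : AEMeasurable (fun q : (ℂ × ℂ) × ℂ => h q.1 * ‖(q.1.1 - q.2)⁻¹‖ₑ)
      ((μ.prod ν).prod μ) :=
    (hh.comp_quasiMeasurePreserving Measure.quasiMeasurePreserving_fst).mul (by fun_prop)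
  have hmp := measurePreserving_exchange μ ν
  have e : ∫⁻ q, h (q.2, q.1.2) * ‖(q.2 - q.1.1)⁻¹‖ₑ ∂((μ.prod ν).prod μ)
      = ∫⁻ q, h q.1 * ‖(q.1.1 - q.2)⁻¹‖ₑ ∂((μ.prod ν).prod μ) := by
    conv_rhs => rw [← hmp.map_eq]
    rw [lintegral_map' (by rwa [hmp.map_eq]) hmp.measurable.aemeasurable]
  rw [e, lintegral_prod _ hm, ← lintegral_const_mul'' _ hh]
  refine lintegral_mono fun w => ?_
  simp only
  rw [lintegral_const_mul _ (by fun_prop), mul_comm]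
  gcongr
  exact hA.lintegral_le _

lemma aestronglyMeasurable_cauchyFst_integrand (hF : AEStronglyMeasurable F (μ.prod ν)) :
    AEStronglyMeasurable (fun q : (ℂ × ℂ) × ℂ => F (q.2, q.1.2) / (q.2 - q.1.1))
      ((μ.prod ν).prod μ) := by
  simp only [div_eq_mul_inv]
  exact (hF.comp_quasiMeasurePreserving (quasiMeasurePreserving_source μ ν)).mul
    (Measurable.aestronglyMeasurable (by fun_prop))

lemma integrable_cauchyFst_integrand (hA : CauchyMassLE μ A) (hA' : A ≠ ⊤)
    (hF : Integrable F (μ.prod ν)) :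
    Integrable (fun q : (ℂ × ℂ) × ℂ => F (q.2, q.1.2) / (q.2 - q.1.1)) ((μ.prod ν).prod μ) := by
  refine ⟨aestronglyMeasurable_cauchyFst_integrand hF.1, ?_⟩
  rw [hasFiniteIntegral_iff_enorm]
  simp only [div_eq_mul_inv, enorm_mul]
  exact (lintegral_lintegral_cauchyFst_le hA hF.1.enorm).trans_lt
    (ENNReal.mul_lt_top hA'.lt_top hF.2)

lemma aestronglyMeasurable_cauchyFst (hF : AEStronglyMeasurable F (μ.prod ν)) :
    AEStronglyMeasurable (cauchyFst μ F) (μ.prod ν) :=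
  (aestronglyMeasurable_cauchyFst_integrand hF).integral_prod_right'

lemma cauchyFst_congr_ae (h : F =ᵐ[μ.prod ν] G) : cauchyFst μ F =ᵐ[μ.prod ν] cauchyFst μ G := by
  have h1 := (quasiMeasurePreserving_source μ ν).ae_eq_comp h
  filter_upwards [Measure.ae_ae_of_ae_prod h1] with z hz
  refine integral_congr_ae ?_
  filter_upwards [hz] with ζ hζ
  simp only [Function.comp_apply] at hζ
  rw [hζ]

/-- Jensen on each slice costs `A ^ (q - 1)` and Tonelli costs one more `A`; the `q`-th root of `A ^
q` is the stated constant. -/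
lemma eLpNorm_cauchyFst_le (hA : CauchyMassLE μ A) {p : ℝ≥0∞} (hp : 1 ≤ p) (hp' : p ≠ ⊤)
    (hF : AEStronglyMeasurable F (μ.prod ν)) :
    eLpNorm (cauchyFst μ F) p (μ.prod ν) ≤ A * eLpNorm F p (μ.prod ν) := by
  have hp0 : p ≠ 0 := (zero_lt_one.trans_le hp).ne'
  have hq : 1 ≤ p.toReal := by
    rw [← ENNReal.toReal_one]; exact ENNReal.toReal_mono hp' hp
  set q := p.toReal
  have hq0 : 0 < q := by linarith
  have hsrc := hF.comp_quasiMeasurePreserving (quasiMeasurePreserving_source μ ν)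
  have hpt : ∀ᵐ z ∂(μ.prod ν), ‖cauchyFst μ F z‖ₑ ^ q
      ≤ A ^ (q - 1) * ∫⁻ ζ, ‖F (ζ, z.2)‖ₑ ^ q * ‖(ζ - z.1)⁻¹‖ₑ ∂μ := by
    filter_upwards [hsrc.prodMk_left] with z hz
    simp only [Function.comp_def] at hz
    calc ‖cauchyFst μ F z‖ₑ ^ q ≤ (∫⁻ ζ, ‖F (ζ, z.2)‖ₑ * ‖(ζ - z.1)⁻¹‖ₑ ∂μ) ^ q := by
          gcongr
          refine (enorm_integral_le_lintegral_enorm _).trans_eq ?_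
          simp only [div_eq_mul_inv, enorm_mul]
      _ ≤ _ := lintegral_mul_rpow_le hz.enorm (by fun_prop) hq
      _ ≤ _ := by
          gcongr
          exact hA _
  have hme : AEMeasurable (fun w => ‖F w‖ₑ ^ q) (μ.prod ν) := hF.enorm.pow_const q
  have hint : ∫⁻ z, ‖cauchyFst μ F z‖ₑ ^ q ∂(μ.prod ν)
      ≤ A ^ q * ∫⁻ w, ‖F w‖ₑ ^ q ∂(μ.prod ν) := by
    have hmm : AEMeasurable (fun q' : (ℂ × ℂ) × ℂ =>
        ‖F (q'.2, q'.1.2)‖ₑ ^ q * ‖(q'.2 - q'.1.1)⁻¹‖ₑ) ((μ.prod ν).prod μ) :=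
      (hsrc.enorm.pow_const q).mul (by fun_prop)
    calc _ ≤ ∫⁻ z, A ^ (q - 1) * ∫⁻ ζ, ‖F (ζ, z.2)‖ₑ ^ q * ‖(ζ - z.1)⁻¹‖ₑ ∂μ ∂(μ.prod ν) :=
          lintegral_mono_ae hpt
      _ = A ^ (q - 1) * ∫⁻ z, ∫⁻ ζ, ‖F (ζ, z.2)‖ₑ ^ q * ‖(ζ - z.1)⁻¹‖ₑ ∂μ ∂(μ.prod ν) :=
          lintegral_const_mul'' _ hmm.lintegral_prod_right'
      _ ≤ A ^ (q - 1) * (A * ∫⁻ w, ‖F w‖ₑ ^ q ∂(μ.prod ν)) := by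
          gcongr
          rw [← lintegral_prod _ hmm]
          exact lintegral_lintegral_cauchyFst_le hA hme
      _ = _ := by
          rw [← mul_assoc]
          congr 1
          conv_lhs => rw [← ENNReal.rpow_one A, ← ENNReal.rpow_mul, one_mul]
          rw [← ENNReal.rpow_add_of_nonneg _ _ (by linarith) zero_le_one, sub_add_cancel]
  rw [eLpNorm_eq_lintegral_rpow_enorm_toReal hp0 hp', eLpNorm_eq_lintegral_rpow_enorm_toReal hp0 hp']
  calc _ ≤ (A ^ q * ∫⁻ w, ‖F w‖ₑ ^ q ∂(μ.prod ν)) ^ (1 / q) := by gcongr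
    _ = _ := by
      rw [ENNReal.mul_rpow_of_nonneg _ _ (by positivity), ← ENNReal.rpow_mul,
        mul_one_div_cancel hq0.ne', ENNReal.rpow_one]

lemma integrable_cauchyFst (hA : CauchyMassLE μ A) (hA' : A ≠ ⊤) (hF : Integrable F (μ.prod ν)) :
    Integrable (cauchyFst μ F) (μ.prod ν) :=
  (integrable_cauchyFst_integrand hA hA' hF).integral_prod_left

lemma integrable_cauchyFst_ae (hA : CauchyMassLE μ A) (hA' : A ≠ ⊤)
    (hF : Integrable F (μ.prod ν)) :
    ∀ᵐ z ∂(μ.prod ν), Integrable (fun ζ => F (ζ, z.2) / (ζ - z.1)) μ :=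
  (integrable_cauchyFst_integrand hA hA' hF).prod_right_ae

/-- The transpose of the Cauchy transform in the first variable. -/
lemma integral_cauchyFst_mul (hA : CauchyMassLE μ A) (hA' : A ≠ ⊤) (hF : Integrable F (μ.prod ν))
    {Φ : ℂ × ℂ → ℂ} (hΦ : Continuous Φ) (hc : HasCompactSupport Φ) :
    ∫ z, cauchyFst μ F z * Φ z ∂(μ.prod ν)
      = ∫ w, F w * ∫ z, Φ (z, w.2) / (w.1 - z) ∂μ ∂(μ.prod ν) := by
  obtain ⟨M, hM⟩ := hc.exists_bound_of_continuous hΦ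
  have hI : Integrable (fun q : (ℂ × ℂ) × ℂ => F (q.2, q.1.2) / (q.2 - q.1.1) * Φ q.1)
      ((μ.prod ν).prod μ) :=
    (integrable_cauchyFst_integrand hA hA' hF).mul_bdd
      (hΦ.comp continuous_fst).aestronglyMeasurable (.of_forall fun q => hM _)
  have hmp := measurePreserving_exchange μ ν
  have hJ : Integrable (fun q : (ℂ × ℂ) × ℂ => F q.1 / (q.1.1 - q.2) * Φ (q.2, q.1.2))
      ((μ.prod ν).prod μ) := hmp.integrable_comp_of_integrable hI
  calc _ = ∫ z, ∫ ζ, F (ζ, z.2) / (ζ - z.1) * Φ z ∂μ ∂(μ.prod ν) := by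
        simp only [cauchyFst, integral_mul_const]
    _ = ∫ q, F (q.2, q.1.2) / (q.2 - q.1.1) * Φ q.1 ∂((μ.prod ν).prod μ) :=
        (integral_prod _ hI).symm
    _ = ∫ q, F q.1 / (q.1.1 - q.2) * Φ (q.2, q.1.2) ∂((μ.prod ν).prod μ) := by
        conv_rhs => rw [← hmp.map_eq]
        rw [integral_map hmp.measurable.aemeasurable (by rw [hmp.map_eq]; exact hJ.1)]
    _ = ∫ w, ∫ z, F w / (w.1 - z) * Φ (z, w.2) ∂μ ∂(μ.prod ν) := integral_prod _ hJ
    _ = _ := by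
        refine integral_congr_ae (.of_forall fun w => ?_)
        simp only
        rw [← integral_const_mul]
        refine integral_congr_ae (.of_forall fun z => ?_)
        simp only
        ring

lemma cauchySnd_congr_ae (h : F =ᵐ[μ.prod ν] G) : cauchySnd ν F =ᵐ[μ.prod ν] cauchySnd ν G := by
  have hs {μ ν : Measure ℂ} [SFinite μ] [SFinite ν] :=
    (Measure.measurePreserving_swap (μ := μ) (ν := ν)).quasiMeasurePreserving
  exact hs.ae_eq_comp (cauchyFst_congr_ae (hs.ae_eq_comp h))

lemma aestronglyMeasurable_cauchySnd (hF : AEStronglyMeasurable F (μ.prod ν)) :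
    AEStronglyMeasurable (cauchySnd ν F) (μ.prod ν) :=
  (aestronglyMeasurable_cauchyFst hF.prod_swap).prod_swap

lemma integrable_cauchySnd (hA : CauchyMassLE ν A) (hA' : A ≠ ⊤) (hF : Integrable F (μ.prod ν)) :
    Integrable (cauchySnd ν F) (μ.prod ν) :=
  (integrable_cauchyFst hA hA' hF.swap).swap

lemma eLpNorm_comp_swap {p : ℝ≥0∞} (hF : AEStronglyMeasurable F (μ.prod ν)) :
    eLpNorm (F ∘ Prod.swap) p (ν.prod μ) = eLpNorm F p (μ.prod ν) :=
  eLpNorm_comp_measurePreserving hF Measure.measurePreserving_swap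

lemma eLpNorm_cauchySnd_le (hA : CauchyMassLE ν A) {p : ℝ≥0∞} (hp : 1 ≤ p) (hp' : p ≠ ⊤)
    (hF : AEStronglyMeasurable F (μ.prod ν)) :
    eLpNorm (cauchySnd ν F) p (μ.prod ν) ≤ A * eLpNorm F p (μ.prod ν) := by
  rw [← eLpNorm_comp_swap hF]
  exact (eLpNorm_comp_swap (aestronglyMeasurable_cauchyFst hF.prod_swap)).trans_le
    (eLpNorm_cauchyFst_le hA hp hp' hF.prod_swap)

lemma integrable_cauchySnd_ae (hA : CauchyMassLE ν A) (hA' : A ≠ ⊤)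
    (hF : Integrable F (μ.prod ν)) :
    ∀ᵐ z ∂(μ.prod ν), Integrable (fun ζ => F (z.1, ζ) / (ζ - z.2)) ν :=
  Measure.measurePreserving_swap.quasiMeasurePreserving.ae
    (integrable_cauchyFst_ae hA hA' hF.swap)

/-- Fubini is arranged so that the innermost integral runs over the first variable with `ζ` and `b`
fixed. A weak equation in `z̄₁` on slices can then be applied there. -/
lemma integral_cauchySnd_mul (hA : CauchyMassLE ν A) (hA' : A ≠ ⊤) (hF : Integrable F (μ.prod ν))
    {Φ : ℂ × ℂ → ℂ} (hΦ : Continuous Φ) (hc : HasCompactSupport Φ) :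
    ∫ z, cauchySnd ν F z * Φ z ∂(μ.prod ν)
      = ∫ b, ∫ ζ, (∫ z, F (z, ζ) * Φ (z, b) ∂μ) / (ζ - b) ∂ν ∂ν := by
  obtain ⟨M, hM⟩ := hc.exists_bound_of_continuous hΦ
  have hsw : MeasurePreserving (Prod.map Prod.swap id : (ℂ × ℂ) × ℂ → (ℂ × ℂ) × ℂ)
      ((μ.prod ν).prod ν) ((ν.prod μ).prod ν) :=
    Measure.measurePreserving_swap.prod (MeasurePreserving.id ν)
  have hI : Integrable (fun q : (ℂ × ℂ) × ℂ => F (q.1.1, q.2) / (q.2 - q.1.2) * Φ q.1)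
      ((μ.prod ν).prod ν) :=
    (hsw.integrable_comp_of_integrable (integrable_cauchyFst_integrand hA hA' hF.swap)).mul_bdd
      (hΦ.comp continuous_fst).aestronglyMeasurable (.of_forall fun q => hM _)
  have hmp := measurePreserving_prodAssoc μ ν ν
  have hJ : Integrable (fun q : ℂ × ℂ × ℂ => F (q.1, q.2.2) / (q.2.2 - q.2.1) * Φ (q.1, q.2.1))
      (μ.prod (ν.prod ν)) :=
    (hmp.integrable_comp_emb MeasurableEquiv.prodAssoc.measurableEmbedding).1 hI
  calc _ = ∫ z, ∫ ζ, F (z.1, ζ) / (ζ - z.2) * Φ z ∂ν ∂(μ.prod ν) := by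
        simp only [cauchySnd, integral_mul_const]
    _ = ∫ q, F (q.1.1, q.2) / (q.2 - q.1.2) * Φ q.1 ∂((μ.prod ν).prod ν) :=
        (integral_prod _ hI).symm
    _ = ∫ q, F (q.1, q.2.2) / (q.2.2 - q.2.1) * Φ (q.1, q.2.1) ∂(μ.prod (ν.prod ν)) :=
        hmp.integral_comp MeasurableEquiv.prodAssoc.measurableEmbedding
          (fun q : ℂ × ℂ × ℂ => F (q.1, q.2.2) / (q.2.2 - q.2.1) * Φ (q.1, q.2.1))
    _ = ∫ w, ∫ z, F (z, w.2) / (w.2 - w.1) * Φ (z, w.1) ∂μ ∂(ν.prod ν) :=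
        integral_prod_symm _ hJ
    _ = ∫ b, ∫ ζ, ∫ z, F (z, ζ) / (ζ - b) * Φ (z, b) ∂μ ∂ν ∂ν :=
        integral_prod _ hJ.integral_prod_right
    _ = _ := by
        refine integral_congr_ae (.of_forall fun b => integral_congr_ae (.of_forall fun ζ => ?_))
        simp only
        rw [← integral_div]
        refine integral_congr_ae (.of_forall fun z => ?_)
        simp only
        ring

/-- Absolute convergence of the double Cauchy integral. -/
lemma integrable_double_cauchy_ae (hA : CauchyMassLE μ A) (hB : CauchyMassLE ν A) (hA' : A ≠ ⊤)
    (hG : Integrable G (μ.prod ν)) :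
    ∀ᵐ z ∂(μ.prod ν),
      Integrable (fun ζ => G ζ / ((ζ.1 - z.1) * (ζ.2 - z.2))) (μ.prod ν) := by
  have hm : AEStronglyMeasurable (fun q : (ℂ × ℂ) × ℂ × ℂ =>
      G q.1 / ((q.1.1 - q.2.1) * (q.1.2 - q.2.2))) ((μ.prod ν).prod (μ.prod ν)) := by
    simp only [div_eq_mul_inv]
    exact hG.1.comp_fst.mul (Measurable.aestronglyMeasurable (by fun_prop))
  have hI : Integrable (fun q : (ℂ × ℂ) × ℂ × ℂ =>
      G q.1 / ((q.1.1 - q.2.1) * (q.1.2 - q.2.2))) ((μ.prod ν).prod (μ.prod ν)) := by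
    refine ⟨hm, ?_⟩
    rw [hasFiniteIntegral_iff_enorm, lintegral_prod _ hm.enorm]
    -- The double kernel is a product of two single kernels, so its mass is at most `A * A`.
    have hle : ∀ ζ : ℂ × ℂ, ∫⁻ z, ‖G ζ / ((ζ.1 - z.1) * (ζ.2 - z.2))‖ₑ ∂(μ.prod ν)
        ≤ (A * A) * ‖G ζ‖ₑ := by
      intro ζ
      simp only [div_eq_mul_inv, mul_inv, enorm_mul]
      rw [lintegral_const_mul _ (by fun_prop),
        lintegral_prod_mul (f := fun z => ‖(ζ.1 - z)⁻¹‖ₑ) (g := fun z => ‖(ζ.2 - z)⁻¹‖ₑ)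
          (by fun_prop) (by fun_prop), mul_comm]
      gcongr
      · exact hA.lintegral_le _
      · exact hB.lintegral_le _
    refine (lintegral_mono hle).trans_lt ?_
    rw [lintegral_const_mul'' _ hG.1.enorm]
    exact ENNReal.mul_lt_top (ENNReal.mul_lt_top hA'.lt_top hA'.lt_top) hG.2
  exact hI.prod_left_ae

lemma double_cauchy_eq_ae (hA : CauchyMassLE μ A) (hB : CauchyMassLE ν A) (hA' : A ≠ ⊤)
    (hG : Integrable G (μ.prod ν)) :
    (fun z => ∫ ζ, G ζ / ((ζ.1 - z.1) * (ζ.2 - z.2)) ∂(μ.prod ν))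
      =ᵐ[μ.prod ν] cauchyFst μ (cauchySnd ν G) := by
  filter_upwards [integrable_double_cauchy_ae hA hB hA' hG] with z hz
  rw [integral_prod _ hz, cauchyFst]
  refine integral_congr_ae (.of_forall fun ζ => ?_)
  simp only [cauchySnd]
  rw [← integral_div]
  refine integral_congr_ae (.of_forall fun w => ?_)
  simp only
  rw [div_div, mul_comm]

end

/-! ### Wirtinger derivatives, slices and tensor products of test functions. -/

/-- The Wirtinger derivative `∂ψ/∂z̄` in one variable. -/
noncomputable def dbar (ψ : ℂ → ℂ) (z : ℂ) : ℂ :=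
  (fderiv ℝ ψ z 1 + Complex.I * fderiv ℝ ψ z Complex.I) / 2

lemma dbar₁_eq_dbar {φ : ℂ × ℂ → ℂ} (hφ : Differentiable ℝ φ) (z w : ℂ) :
    dbar₁ φ (z, w) = dbar (fun z => φ (z, w)) z := by
  have h : HasFDerivAt (fun z => φ (z, w)) _ z :=
    (hφ (z, w)).hasFDerivAt.comp z (hasFDerivAt_prodMk_left z w)
  rw [dbar, h.fderiv]
  rfl

lemma dbar₂_eq_dbar₁_swap {φ : ℂ × ℂ → ℂ} (hφ : Differentiable ℝ φ) (z : ℂ × ℂ) :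
    dbar₂ φ z.swap = dbar₁ (φ ∘ Prod.swap) z := by
  have h : HasFDerivAt (φ ∘ Prod.swap) _ z :=
    (hφ z.swap).hasFDerivAt.comp z (ContinuousLinearEquiv.prodComm ℝ ℂ ℂ).hasFDerivAt
  rw [dbar₁, h.fderiv]
  rfl

lemma continuous_dbar {ψ : ℂ → ℂ} (hψ : ContDiff ℝ ∞ ψ) : Continuous (dbar ψ) := by
  have h : Continuous (fderiv ℝ ψ) := hψ.continuous_fderiv (by simp)
  unfold dbar
  fun_prop

lemma continuous_dbar₁ {φ : ℂ × ℂ → ℂ} (hφ : ContDiff ℝ ∞ φ) : Continuous (dbar₁ φ) := by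
  have h : Continuous (fderiv ℝ φ) := hφ.continuous_fderiv (by simp)
  unfold dbar₁
  fun_prop

lemma dbar_eq_zero {ψ : ℂ → ℂ} {z : ℂ} (hz : z ∉ tsupport ψ) : dbar ψ z = 0 := by
  have : fderiv ℝ ψ z = 0 :=
    image_eq_zero_of_notMem_tsupport fun h => hz (tsupport_fderiv_subset ℝ h)
  simp [dbar, this]

lemma dbar₁_eq_zero {φ : ℂ × ℂ → ℂ} {z : ℂ × ℂ} (hz : z ∉ tsupport φ) : dbar₁ φ z = 0 := by
  have : fderiv ℝ φ z = 0 :=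
    image_eq_zero_of_notMem_tsupport fun h => hz (tsupport_fderiv_subset ℝ h)
  simp [dbar₁, this]

lemma hasCompactSupport_dbar {ψ : ℂ → ℂ} (hψ : HasCompactSupport ψ) :
    HasCompactSupport (dbar ψ) :=
  HasCompactSupport.intro hψ fun _ hz => dbar_eq_zero hz

lemma hasCompactSupport_dbar₁ {φ : ℂ × ℂ → ℂ} (hφ : HasCompactSupport φ) :
    HasCompactSupport (dbar₁ φ) :=
  HasCompactSupport.intro hφ fun _ hz => dbar₁_eq_zero hz

section

variable {D₁ D₂ : Set ℂ} {φ : ℂ × ℂ → ℂ}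

lemma IsTestFunction.comp_swap (h : IsTestFunction (D₁ ×ˢ D₂) φ) :
    IsTestFunction (D₂ ×ˢ D₁) (φ ∘ Prod.swap) := by
  refine ⟨h.1.comp (contDiff_snd.prodMk contDiff_fst),
    h.2.1.comp_homeomorph (Homeomorph.prodComm ℂ ℂ), fun z hz => ?_⟩
  have h1 : z.swap ∈ tsupport φ := tsupport_comp_subset_preimage φ continuous_swap hz
  exact ⟨(h.2.2 h1).2, (h.2.2 h1).1⟩

lemma tsupport_slice_subset (φ : ℂ × ℂ → ℂ) (w : ℂ) :
    tsupport (fun z => φ (z, w)) ⊆ (fun z => (z, w)) ⁻¹' tsupport φ :=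
  tsupport_comp_subset_preimage φ (by fun_prop)

lemma IsTestFunction.slice (h : IsTestFunction (D₁ ×ˢ D₂) φ) (w : ℂ) :
    ContDiff ℝ ∞ (fun z => φ (z, w)) ∧ HasCompactSupport (fun z => φ (z, w)) ∧
      tsupport (fun z => φ (z, w)) ⊆ D₁ := by
  refine ⟨h.1.comp (by fun_prop), ?_, fun z hz => (h.2.2 (tsupport_slice_subset φ w hz)).1⟩
  exact (h.2.1.image continuous_fst).of_isClosed_subset (isClosed_tsupport _)
    fun z hz => ⟨(z, w), tsupport_slice_subset φ w hz, rfl⟩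

lemma isTestFunction_mul {ψ : ℂ → ℂ} (hψ : ContDiff ℝ ∞ ψ) (hψc : HasCompactSupport ψ)
    (hψs : tsupport ψ ⊆ D₁) {η : ℂ → ℝ} (hη : ContDiff ℝ ∞ η) (hηc : HasCompactSupport η)
    (hηs : tsupport η ⊆ D₂) :
    IsTestFunction (D₁ ×ˢ D₂) (fun z => ψ z.1 * (η z.2 : ℂ)) := by
  have hsub : tsupport (fun z : ℂ × ℂ => ψ z.1 * (η z.2 : ℂ)) ⊆ tsupport ψ ×ˢ tsupport η := by
    refine closure_minimal (fun z hz => ?_) ((isClosed_tsupport _).prod (isClosed_tsupport _))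
    rw [Function.mem_support, mul_ne_zero_iff] at hz
    exact ⟨subset_tsupport _ hz.1, subset_tsupport _ fun h => hz.2 (by simp [h])⟩
  refine ⟨(hψ.comp contDiff_fst).mul (Complex.ofRealCLM.contDiff.comp (hη.comp contDiff_snd)),
    (hψc.isCompact.prod hηc.isCompact).of_isClosed_subset (isClosed_tsupport _) hsub,
    hsub.trans (prod_mono hψs hηs)⟩

lemma dbar₁_mul {ψ : ℂ → ℂ} {η : ℂ → ℝ} (h : IsTestFunction (D₁ ×ˢ D₂)
      (fun z => ψ z.1 * (η z.2 : ℂ))) (hψ : Differentiable ℝ ψ) (z : ℂ × ℂ) :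
    dbar₁ (fun z => ψ z.1 * (η z.2 : ℂ)) z = dbar ψ z.1 * η z.2 := by
  rw [← Prod.mk.eta (p := z), dbar₁_eq_dbar (h.1.differentiable (by simp))]
  simp only [dbar]
  rw [fderiv_mul_const (hψ _)]
  simp only [smul_apply, smul_eq_mul]
  ring

/-- The slice is supported inside `D₁`, so Cauchy–Pompeiu on the plane applies without a boundary
term, for every `a` and `b`. -/
lemma setIntegral_dbar₁_div (hφ : IsTestFunction (D₁ ×ˢ D₂) φ) (a b : ℂ) :
    ∫ z in D₁, dbar₁ φ (z, b) / (a - z) = Real.pi * φ (a, b) := by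
  obtain ⟨h1, h2, h3⟩ := hφ.slice b
  simp only [dbar₁_eq_dbar (hφ.1.differentiable (by simp))]
  rw [setIntegral_eq_integral_of_forall_compl_eq_zero]
  · exact integral_dbar_div_sub (h1.of_le (by simp)) h2 a
  · intro z hz
    rw [dbar_eq_zero fun h => hz (h3 h), zero_div]

end

/-! ### Weak derivatives of Cauchy transforms and the solution operator. -/

section

variable {D₁ D₂ : Set ℂ} {φ F G F₁ F₂ : ℂ × ℂ → ℂ} {A : ℝ≥0∞}

lemma volume_restrict_prod (D₁ D₂ : Set ℂ) :
    (volume.restrict (D₁ ×ˢ D₂) : Measure (ℂ × ℂ))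
      = (volume.restrict D₁).prod (volume.restrict D₂) := by
  rw [Measure.prod_restrict]; rfl

lemma integral_cauchyFst_mul_dbar₁ (hA : CauchyMassLE (volume.restrict D₁) A) (hA' : A ≠ ⊤)
    (hF : IntegrableOn F (D₁ ×ˢ D₂)) (hφ : IsTestFunction (D₁ ×ˢ D₂) φ) :
    ∫ z in D₁ ×ˢ D₂, cauchyFst (volume.restrict D₁) F z * dbar₁ φ z
      = Real.pi * ∫ z in D₁ ×ˢ D₂, F z * φ z := by
  rw [IntegrableOn, volume_restrict_prod] at hF
  rw [volume_restrict_prod, integral_cauchyFst_mul hA hA' hF (continuous_dbar₁ hφ.1)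
    (hasCompactSupport_dbar₁ hφ.2.1), ← integral_const_mul]
  refine integral_congr_ae (.of_forall fun w => ?_)
  simp only [setIntegral_dbar₁_div hφ]
  ring

/-- A weak equation `∂F/∂z̄₁ = G` on `D₁ × D₂` holds weakly on almost every slice. -/
lemma ae_setIntegral_slice (hD₂ : IsOpen D₂) (hF : IntegrableOn F (D₁ ×ˢ D₂))
    (hG : IntegrableOn G (D₁ ×ˢ D₂))
    (hFG : ∀ φ, IsTestFunction (D₁ ×ˢ D₂) φ →
      ∫ z in D₁ ×ˢ D₂, F z * dbar₁ φ z = -∫ z in D₁ ×ˢ D₂, G z * φ z)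
    {ψ : ℂ → ℂ} (hψ : ContDiff ℝ ∞ ψ) (hψc : HasCompactSupport ψ) (hψs : tsupport ψ ⊆ D₁) :
    ∀ᵐ ζ ∂volume.restrict D₂,
      ∫ z in D₁, F (z, ζ) * dbar ψ z = -∫ z in D₁, G (z, ζ) * ψ z := by
  have hcd := continuous_dbar hψ
  rw [IntegrableOn, volume_restrict_prod] at hF hG
  have hmul : ∀ {H : ℂ × ℂ → ℂ} {k : ℂ × ℂ → ℂ}, Continuous k → (∃ M, ∀ z, ‖k z‖ ≤ M) →
      Integrable H ((volume.restrict D₁).prod (volume.restrict D₂)) →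
      Integrable (fun z => H z * k z) ((volume.restrict D₁).prod (volume.restrict D₂)) := by
    rintro H k hk ⟨M, hM⟩ hH
    exact hH.mul_bdd hk.aestronglyMeasurable (.of_forall hM)
  obtain ⟨M₁, hM₁⟩ := (hasCompactSupport_dbar hψc).exists_bound_of_continuous hcd
  obtain ⟨M₂, hM₂⟩ := hψc.exists_bound_of_continuous hψ.continuous
  have hFi := hmul (k := fun z => dbar ψ z.1) (by fun_prop) ⟨M₁, fun z => hM₁ z.1⟩ hF
  have hGi := hmul (k := fun z => ψ z.1) (hψ.continuous.comp continuous_fst)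
    ⟨M₂, fun z => hM₂ z.1⟩ hG
  have hS := hFi.add hGi
  -- Testing the equation on products `ψ(z₁) η(z₂)` with `η` arbitrary shows that the slice defect
  -- vanishes for almost every `ζ`. The exceptional null set depends on `ψ`.
  have key : ∀ᵐ ζ, ζ ∈ D₂ → ∫ z in D₁, (F (z, ζ) * dbar ψ z + G (z, ζ) * ψ z) = 0 := by
    refine hD₂.ae_eq_zero_of_integral_contDiff_smul_eq_zero
      (IntegrableOn.locallyIntegrableOn hS.integral_prod_right) fun η hη hηc hηs => ?_
    have ht := isTestFunction_mul hψ hψc hψs hη hηc hηs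
    obtain ⟨M₃, hM₃⟩ := hηc.exists_bound_of_continuous hη.continuous
    have hηm : ∀ {H}, Integrable H ((volume.restrict D₁).prod (volume.restrict D₂)) →
        Integrable (fun z => H z * (η z.2 : ℂ))
          ((volume.restrict D₁).prod (volume.restrict D₂)) := fun hH =>
      hmul (k := fun z => (η z.2 : ℂ))
        (Complex.continuous_ofReal.comp (hη.continuous.comp continuous_snd))
        ⟨M₃, fun z => by simpa using hM₃ z.2⟩ hH
    have hzero : ∀ ζ ∉ D₂, η ζ • ∫ z in D₁, (F (z, ζ) * dbar ψ z + G (z, ζ) * ψ z) = 0 := by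
      intro ζ hζ
      rw [image_eq_zero_of_notMem_tsupport fun h => hζ (hηs h), zero_smul]
    rw [← setIntegral_eq_integral_of_forall_compl_eq_zero hzero]
    have h1 := hFG _ ht
    simp only [dbar₁_mul ht (hψ.differentiable (by simp)), ← mul_assoc] at h1
    rw [volume_restrict_prod] at h1
    calc _ = ∫ ζ in D₂, ∫ z in D₁,
          (F (z, ζ) * dbar ψ z + G (z, ζ) * ψ z) * (η ζ : ℂ) := by
          refine integral_congr_ae (.of_forall fun ζ => ?_)
          simp only [integral_mul_const, Complex.real_smul]
          ring
      _ = ∫ z, (F z * dbar ψ z.1 + G z * ψ z.1) * (η z.2 : ℂ)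
            ∂((volume.restrict D₁).prod (volume.restrict D₂)) :=
          (integral_prod_symm _ (hηm hS)).symm
      _ = 0 := by
          simp only [add_mul]
          rw [integral_add (hηm hFi) (hηm hGi), h1, neg_add_cancel]
  rw [ae_restrict_iff' hD₂.measurableSet]
  have e1 := (ae_restrict_iff' hD₂.measurableSet).1 hFi.prod_left_ae
  have e2 := (ae_restrict_iff' hD₂.measurableSet).1 hGi.prod_left_ae
  filter_upwards [key, e1, e2] with ζ h h1 h2 hζ
  rw [eq_neg_iff_add_eq_zero, ← integral_add (h1 hζ) (h2 hζ), h hζ]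

/-- The Cauchy transform in the second variable commutes with weak `∂/∂z̄₁`. -/
lemma integral_cauchySnd_mul_dbar₁ (hA : CauchyMassLE (volume.restrict D₂) A) (hA' : A ≠ ⊤)
    (hD₂ : IsOpen D₂) (hF : IntegrableOn F (D₁ ×ˢ D₂)) (hG : IntegrableOn G (D₁ ×ˢ D₂))
    (hFG : ∀ φ, IsTestFunction (D₁ ×ˢ D₂) φ →
      ∫ z in D₁ ×ˢ D₂, F z * dbar₁ φ z = -∫ z in D₁ ×ˢ D₂, G z * φ z)
    (hφ : IsTestFunction (D₁ ×ˢ D₂) φ) :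
    ∫ z in D₁ ×ˢ D₂, cauchySnd (volume.restrict D₂) F z * dbar₁ φ z
      = -∫ z in D₁ ×ˢ D₂, cauchySnd (volume.restrict D₂) G z * φ z := by
  have hs := fun b => hφ.slice b
  -- The slice of `φ` at `b` serves as `ψ`. The null set of bad `ζ` varies with `b`, which is
  -- harmless since `b` is fixed in the inner integral.
  have hsl := fun b => ae_setIntegral_slice hD₂ hF hG hFG (hs b).1 (hs b).2.1 (hs b).2.2
  rw [IntegrableOn, volume_restrict_prod] at hF hG
  rw [volume_restrict_prod, integral_cauchySnd_mul hA hA' hF (continuous_dbar₁ hφ.1)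
    (hasCompactSupport_dbar₁ hφ.2.1), integral_cauchySnd_mul hA hA' hG hφ.1.continuous hφ.2.1,
    ← integral_neg]
  refine integral_congr_ae (.of_forall fun b => ?_)
  simp only
  rw [← integral_neg]
  refine integral_congr_ae ?_
  filter_upwards [hsl b] with ζ hζ
  simp only [dbar₁_eq_dbar (hφ.1.differentiable (by simp))]
  rw [hζ, neg_div]

/-- The solution operator on a product, in terms of Cauchy transforms. -/
noncomputable def cauchySol (μ ν : Measure ℂ) (F₁ F₂ G : ℂ × ℂ → ℂ) (z : ℂ × ℂ) : ℂ :=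
  -(1 / Real.pi) * (cauchySnd ν F₂ z + cauchyFst μ F₁ z +
    (1 / Real.pi) * ∫ ζ, G ζ / ((ζ.1 - z.1) * (ζ.2 - z.2)) ∂(μ.prod ν))

lemma cauchySol_ae_eq {μ ν : Measure ℂ} [SFinite μ] [SFinite ν] (hA : CauchyMassLE μ A)
    (hB : CauchyMassLE ν A) (hA' : A ≠ ⊤) (hG : Integrable G (μ.prod ν)) :
    cauchySol μ ν F₁ F₂ G =ᵐ[μ.prod ν] (-(1 / Real.pi) : ℂ) • (cauchySnd ν F₂ + cauchyFst μ F₁ +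
      (1 / Real.pi : ℂ) • cauchyFst μ (cauchySnd ν G)) := by
  filter_upwards [double_cauchy_eq_ae hA hB hA' hG] with z hz
  simp only [cauchySol, Pi.smul_apply, Pi.add_apply, smul_eq_mul]
  rw [hz]

lemma cauchySol_swap {μ ν : Measure ℂ} [SFinite μ] [SFinite ν] (z : ℂ × ℂ) :
    cauchySol ν μ (F₂ ∘ Prod.swap) (F₁ ∘ Prod.swap) (G ∘ Prod.swap) z
      = cauchySol μ ν F₁ F₂ G z.swap := by
  have h := integral_prod_swap (μ := μ) (ν := ν)
    fun ζ : ℂ × ℂ => G ζ / ((ζ.1 - z.2) * (ζ.2 - z.1))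
  simp only [cauchySol, Prod.fst_swap, Prod.snd_swap]
  rw [← h]
  simp only [cauchySnd, cauchyFst, Function.comp_apply, Prod.swap_prod_mk, Prod.fst_swap,
    Prod.snd_swap, mul_comm (_ - z.2) (_ - z.1), add_comm]

/-- The cancellation that dictates the form of `T`: the error `C₂ G` produced by `C₂ F₂` is removed
by the double integral, since `∂/∂z̄₁` of `C₁ C₂ G` is `-π C₂ G`. -/
lemma integral_cauchySol_mul_dbar₁ (hA : CauchyMassLE (volume.restrict D₁) A)
    (hB : CauchyMassLE (volume.restrict D₂) A) (hA' : A ≠ ⊤)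
    (hD₂ : IsOpen D₂) (hF₁ : IntegrableOn F₁ (D₁ ×ˢ D₂)) (hF₂ : IntegrableOn F₂ (D₁ ×ˢ D₂))
    (hG : IntegrableOn G (D₁ ×ˢ D₂))
    (hFG : ∀ φ, IsTestFunction (D₁ ×ˢ D₂) φ →
      ∫ z in D₁ ×ˢ D₂, F₂ z * dbar₁ φ z = -∫ z in D₁ ×ˢ D₂, G z * φ z)
    (hφ : IsTestFunction (D₁ ×ˢ D₂) φ) :
    ∫ z in D₁ ×ˢ D₂, cauchySol (volume.restrict D₁) (volume.restrict D₂) F₁ F₂ G z * dbar₁ φ z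
      = -∫ z in D₁ ×ˢ D₂, F₁ z * φ z := by
  have e₂ := integral_cauchySnd_mul_dbar₁ hB hA' hD₂ hF₂ hG hFG hφ
  have e₁ := integral_cauchyFst_mul_dbar₁ hA hA' hF₁ hφ
  have hF₁' := hF₁
  have hF₂' := hF₂
  have hG' := hG
  rw [IntegrableOn, volume_restrict_prod] at hF₁' hF₂' hG'
  have hSG : IntegrableOn (cauchySnd (volume.restrict D₂) G) (D₁ ×ˢ D₂) := by
    rw [IntegrableOn, volume_restrict_prod]
    exact integrable_cauchySnd hB hA' hG'
  have e₃ := integral_cauchyFst_mul_dbar₁ hA hA' hSG hφ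
  rw [IntegrableOn, volume_restrict_prod] at hSG
  rw [volume_restrict_prod] at e₁ e₂ e₃ ⊢
  obtain ⟨M, hM⟩ := (hasCompactSupport_dbar₁ hφ.2.1).exists_bound_of_continuous
    (continuous_dbar₁ hφ.1)
  have hmul : ∀ {H : ℂ × ℂ → ℂ},
      Integrable H ((volume.restrict D₁).prod (volume.restrict D₂)) →
      Integrable (fun z => H z * dbar₁ φ z)
        ((volume.restrict D₁).prod (volume.restrict D₂)) := fun hH =>
    hH.mul_bdd (continuous_dbar₁ hφ.1).aestronglyMeasurable (.of_forall hM)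
  have i₁ := hmul (integrable_cauchyFst hA hA' hF₁')
  have i₂ := hmul (integrable_cauchySnd hB hA' hF₂')
  have i₃ := hmul (integrable_cauchyFst hA hA' hSG)
  have i₁₂ : Integrable (fun z => cauchySnd (volume.restrict D₂) F₂ z * dbar₁ φ z +
      cauchyFst (volume.restrict D₁) F₁ z * dbar₁ φ z)
      ((volume.restrict D₁).prod (volume.restrict D₂)) := i₂.add i₁
  have hpi : (Real.pi : ℂ) ≠ 0 := by exact_mod_cast Real.pi_ne_zero
  calc _ = ∫ z, -(1 / Real.pi : ℂ) * (cauchySnd (volume.restrict D₂) F₂ z * dbar₁ φ z +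
          cauchyFst (volume.restrict D₁) F₁ z * dbar₁ φ z + (1 / Real.pi : ℂ) *
          (cauchyFst (volume.restrict D₁) (cauchySnd (volume.restrict D₂) G) z * dbar₁ φ z))
          ∂((volume.restrict D₁).prod (volume.restrict D₂)) := by
        refine integral_congr_ae ?_
        filter_upwards [cauchySol_ae_eq (F₁ := F₁) (F₂ := F₂) hA hB hA' hG'] with z hz
        rw [hz]
        simp only [Pi.smul_apply, Pi.add_apply, smul_eq_mul]
        ring
    _ = _ := by
        rw [integral_const_mul, integral_add i₁₂ (i₃.const_mul _), integral_add i₂ i₁,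
          integral_const_mul, e₁, e₂, e₃]
        field_simp
        ring

lemma integral_cauchySol_mul_dbar₂ (hA : CauchyMassLE (volume.restrict D₁) A)
    (hB : CauchyMassLE (volume.restrict D₂) A) (hA' : A ≠ ⊤)
    (hD₁ : IsOpen D₁) (hF₁ : IntegrableOn F₁ (D₁ ×ˢ D₂)) (hF₂ : IntegrableOn F₂ (D₁ ×ˢ D₂))
    (hG : IntegrableOn G (D₁ ×ˢ D₂))
    (hFG : ∀ φ, IsTestFunction (D₁ ×ˢ D₂) φ →
      ∫ z in D₁ ×ˢ D₂, F₁ z * dbar₂ φ z = -∫ z in D₁ ×ˢ D₂, G z * φ z)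
    (hφ : IsTestFunction (D₁ ×ˢ D₂) φ) :
    ∫ z in D₁ ×ˢ D₂, cauchySol (volume.restrict D₁) (volume.restrict D₂) F₁ F₂ G z * dbar₂ φ z
      = -∫ z in D₁ ×ˢ D₂, F₂ z * φ z := by
  have hsw : ∀ H : ℂ × ℂ → ℂ, ∫ z in D₂ ×ˢ D₁, H z.swap = ∫ z in D₁ ×ˢ D₂, H z :=
    fun H => setIntegral_prod_swap (μ := volume) (ν := volume) D₁ D₂ H
  -- The operator is symmetric under exchanging the variables together with `F₁` and `F₂`.
  have key := integral_cauchySol_mul_dbar₁ (F₁ := F₂ ∘ Prod.swap) (F₂ := F₁ ∘ Prod.swap)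
    (G := G ∘ Prod.swap) hB hA hA' hD₁ hF₂.swap hF₁.swap hG.swap ?_ hφ.comp_swap
  · rw [← hsw, ← hsw]
    simp only [dbar₂_eq_dbar₁_swap (hφ.1.differentiable (by simp)), ← cauchySol_swap]
    exact key
  · intro φ' hφ'
    have h := hFG _ hφ'.comp_swap
    rw [← hsw, ← hsw] at h
    simp only [dbar₂_eq_dbar₁_swap (hφ'.comp_swap.1.differentiable (by simp))] at h
    simpa [Function.comp_def] using h

lemma aestronglyMeasurable_cauchySol {μ ν : Measure ℂ} [SFinite μ] [SFinite ν]
    (hA : CauchyMassLE μ A) (hB : CauchyMassLE ν A) (hA' : A ≠ ⊤)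
    (hF₁ : AEStronglyMeasurable F₁ (μ.prod ν)) (hF₂ : AEStronglyMeasurable F₂ (μ.prod ν))
    (hG : Integrable G (μ.prod ν)) :
    AEStronglyMeasurable (cauchySol μ ν F₁ F₂ G) (μ.prod ν) :=
  ((((aestronglyMeasurable_cauchySnd hF₂).add (aestronglyMeasurable_cauchyFst hF₁)).add
    ((aestronglyMeasurable_cauchyFst (aestronglyMeasurable_cauchySnd hG.1)).const_smul _)).const_smul
      _).congr (cauchySol_ae_eq hA hB hA' hG).symm

lemma eLpNorm_cauchySol_le {μ ν : Measure ℂ} [SFinite μ] [SFinite ν]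
    (hA : CauchyMassLE μ A) (hB : CauchyMassLE ν A) (hA' : A ≠ ⊤) {p : ℝ≥0∞} (hp : 1 ≤ p)
    (hp' : p ≠ ⊤) (hF₁ : AEStronglyMeasurable F₁ (μ.prod ν))
    (hF₂ : AEStronglyMeasurable F₂ (μ.prod ν)) (hG : Integrable G (μ.prod ν)) :
    eLpNorm (cauchySol μ ν F₁ F₂ G) p (μ.prod ν) ≤
      (A + A * A) * (eLpNorm F₁ p (μ.prod ν) + eLpNorm F₂ p (μ.prod ν)
        + eLpNorm G p (μ.prod ν)) := by
  have hpi : ‖(1 / Real.pi : ℂ)‖ₑ ≤ 1 := by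
    rw [← ofReal_norm, ENNReal.ofReal_le_one, norm_div, norm_one, Complex.norm_real,
      Real.norm_of_nonneg Real.pi_pos.le, div_le_one Real.pi_pos]
    linarith [Real.pi_gt_three]
  have m₁ := aestronglyMeasurable_cauchyFst hF₁
  have m₂ := aestronglyMeasurable_cauchySnd hF₂
  have m₃ := aestronglyMeasurable_cauchyFst (aestronglyMeasurable_cauchySnd hG.1)
  rw [eLpNorm_congr_ae (cauchySol_ae_eq hA hB hA' hG), eLpNorm_const_smul, enorm_neg]
  set N₁ := eLpNorm F₁ p (μ.prod ν)
  set N₂ := eLpNorm F₂ p (μ.prod ν)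
  set N₃ := eLpNorm G p (μ.prod ν)
  calc _ ≤ 1 * eLpNorm (cauchySnd ν F₂ + cauchyFst μ F₁ +
        (1 / Real.pi : ℂ) • cauchyFst μ (cauchySnd ν G)) p (μ.prod ν) := by gcongr
    _ ≤ eLpNorm (cauchySnd ν F₂) p (μ.prod ν) + eLpNorm (cauchyFst μ F₁) p (μ.prod ν) +
        eLpNorm ((1 / Real.pi : ℂ) • cauchyFst μ (cauchySnd ν G)) p (μ.prod ν) := by
        rw [one_mul]
        exact (eLpNorm_add_le (m₂.add m₁) (m₃.const_smul _) hp).trans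
          (add_le_add (eLpNorm_add_le m₂ m₁ hp) le_rfl)
    _ ≤ A * N₂ + A * N₁ + 1 * (A * (A * N₃)) := by
        rw [eLpNorm_const_smul]
        gcongr
        · exact eLpNorm_cauchySnd_le hB hp hp' hF₂
        · exact eLpNorm_cauchyFst_le hA hp hp' hF₁
        · exact (eLpNorm_cauchyFst_le hA hp hp' (aestronglyMeasurable_cauchySnd hG.1)).trans
            (by gcongr; exact eLpNorm_cauchySnd_le hB hp hp' hG.1)
    -- Padding by nonnegative terms completes the product `(A + A * A) * (N₁ + N₂ + N₃)`.
    _ ≤ (A * N₂ + A * N₁ + 1 * (A * (A * N₃))) + (A * N₃ + A * A * N₁ + A * A * N₂) :=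
        le_self_add
    _ = _ := by ring

end

/-! ### Specialization to the disc times the punctured disc. -/

lemma solT_eq_cauchySol (D₁ D₂ : Set ℂ) (f : Form01) :
    solT D₁ D₂ f = cauchySol (volume.restrict D₁) (volume.restrict D₂) f.f₁ f.f₂
      (scriptD (D₁ ×ˢ D₂) f) := by
  have hpi : (Real.pi : ℂ) ≠ 0 := by exact_mod_cast Real.pi_ne_zero
  funext z
  rw [solT, cauchySol, ← volume_restrict_prod, cauchySnd, cauchyFst]
  field_simp
  ring

/-- The two forms have the same representing functions, so the choice made in `scriptD` is literally
the same. This gives equality everywhere, not just almost everywhere. -/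
lemma scriptD_congr {Ω : Set (ℂ × ℂ)} {f f' : Form01} (hf : f.LocIntegrableOn Ω)
    (hf' : f'.LocIntegrableOn Ω) (h₁ : f'.f₁ =ᵐ[volume.restrict Ω] f.f₁)
    (h₂ : f'.f₂ =ᵐ[volume.restrict Ω] f.f₂) : scriptD Ω f' = scriptD Ω f := by
  have h : IsScriptD Ω f' = IsScriptD Ω f := by
    funext g
    simp only [IsScriptD, hf, hf', true_and]
    have e₁ : ∀ k : ℂ × ℂ → ℂ, ∫ z in Ω, f'.f₁ z * k z = ∫ z in Ω, f.f₁ z * k z := fun k =>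
      integral_congr_ae (h₁.mul .rfl)
    have e₂ : ∀ k : ℂ × ℂ → ℂ, ∫ z in Ω, f'.f₂ z * k z = ∫ z in Ω, f.f₂ z * k z := fun k =>
      integral_congr_ae (h₂.mul .rfl)
    simp only [e₁, e₂]
  unfold scriptD
  rw [h]

lemma disc_eq_ball : disc = Metric.ball 0 1 := by
  ext z; simp [disc]

lemma puncturedDisc_eq : puncturedDisc = Metric.ball 0 1 \ {0} := by
  ext z; simp [puncturedDisc, and_comm]

lemma isOpen_disc : IsOpen disc := disc_eq_ball ▸ Metric.isOpen_ball

lemma isOpen_puncturedDisc : IsOpen puncturedDisc :=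
  puncturedDisc_eq ▸ Metric.isOpen_ball.sdiff isClosed_singleton

lemma cauchyMassLE_disc : CauchyMassLE (volume.restrict disc) cauchyMass :=
  lintegral_enorm_inv_sub_le disc_eq_ball.subset

lemma cauchyMassLE_puncturedDisc : CauchyMassLE (volume.restrict puncturedDisc) cauchyMass :=
  lintegral_enorm_inv_sub_le (puncturedDisc_eq ▸ sdiff_subset)

instance isFiniteMeasure_restrict_disc : IsFiniteMeasure (volume.restrict disc) :=
  isFiniteMeasure_restrict.2 (disc_eq_ball ▸ measure_ball_lt_top.ne)

instance isFiniteMeasure_restrict_puncturedDisc :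
    IsFiniteMeasure (volume.restrict puncturedDisc) :=
  isFiniteMeasure_restrict.2 (measure_ne_top_of_subset (puncturedDisc_eq ▸ sdiff_subset)
    (measure_ball_lt_top (x := (0 : ℂ)) (r := 1)).ne)

instance isFiniteMeasure_restrict_disc_prod :
    IsFiniteMeasure (volume.restrict (disc ×ˢ puncturedDisc)) := by
  rw [volume_restrict_prod]; infer_instance

end DbarProduct

theorem corollary3p5 (p : ℝ≥0∞) (hp : 1 ≤ p) (hp' : p ≠ ⊤) :
    ∃ C : ℝ, 0 < C ∧ ∀ f : DbarProduct.Form01,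
      DbarProduct.IsWeaklyDbarClosed (DbarProduct.disc ×ˢ DbarProduct.puncturedDisc) f →
      DbarProduct.MemB p (DbarProduct.disc ×ˢ DbarProduct.puncturedDisc) f →
        -- `Tf` is well defined: the integrals converge absolutely almost everywhere,
        (∀ᵐ z ∂(volume.restrict (DbarProduct.disc ×ˢ DbarProduct.puncturedDisc)),
          DbarProduct.SolTConvergesAt DbarProduct.disc DbarProduct.puncturedDisc f z) ∧
        -- and, up to null sets, `Tf` depends only on the classes of `f₁` and `f₂`
        (∀ f' : DbarProduct.Form01,
          f'.f₁ =ᵐ[volume.restrict (DbarProduct.disc ×ˢ DbarProduct.puncturedDisc)] f.f₁ →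
          f'.f₂ =ᵐ[volume.restrict (DbarProduct.disc ×ˢ DbarProduct.puncturedDisc)] f.f₂ →
          DbarProduct.solT DbarProduct.disc DbarProduct.puncturedDisc f'
            =ᵐ[volume.restrict (DbarProduct.disc ×ˢ DbarProduct.puncturedDisc)]
          DbarProduct.solT DbarProduct.disc DbarProduct.puncturedDisc f) ∧
        DbarProduct.IsWeakDbarSolution (DbarProduct.disc ×ˢ DbarProduct.puncturedDisc)
          (DbarProduct.solT DbarProduct.disc DbarProduct.puncturedDisc f) f ∧
        MemLp (DbarProduct.solT DbarProduct.disc DbarProduct.puncturedDisc f) p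
          (volume.restrict (DbarProduct.disc ×ˢ DbarProduct.puncturedDisc)) ∧
        eLpNorm (DbarProduct.solT DbarProduct.disc DbarProduct.puncturedDisc f) p
            (volume.restrict (DbarProduct.disc ×ˢ DbarProduct.puncturedDisc)) ≤
          ENNReal.ofReal C *
            DbarProduct.normB p (DbarProduct.disc ×ˢ DbarProduct.puncturedDisc) f := by
  have hA := DbarProduct.cauchyMassLE_disc
  have hB := DbarProduct.cauchyMassLE_puncturedDisc
  have hA' := DbarProduct.cauchyMass_lt_top.ne
  set A := DbarProduct.cauchyMass
  set D₁ := DbarProduct.disc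
  set D₂ := DbarProduct.puncturedDisc
  have hvol := DbarProduct.volume_restrict_prod D₁ D₂
  have hfin : IsFiniteMeasure (volume.restrict (D₁ ×ˢ D₂)) :=
    DbarProduct.isFiniteMeasure_restrict_disc_prod
  have hAA : A + A * A ≠ ⊤ := ENNReal.add_ne_top.2 ⟨hA', ENNReal.mul_ne_top hA' hA'⟩
  -- The summand 1 only secures positivity.
  refine ⟨(A + A * A).toReal + 1, by positivity, fun f hcl hf => ?_⟩
  obtain ⟨hf₁, hf₂, g, hg, hgp⟩ := hf
  have hS := DbarProduct.isScriptD_scriptD ⟨g, hg⟩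
  have hΩ : IsOpen (D₁ ×ˢ D₂) :=
    DbarProduct.isOpen_disc.prod DbarProduct.isOpen_puncturedDisc
  -- The chosen representative `scriptD` need not be `g`, but it agrees with `g` almost everywhere
  -- and so inherits the `Lᵖ` bound.
  have hSp : MemLp (DbarProduct.scriptD (D₁ ×ˢ D₂) f) p (volume.restrict (D₁ ×ˢ D₂)) :=
    hgp.ae_eq (hg.ae_eq hΩ hS)
  -- `Ω` has finite measure, so `Lᵖ` functions are integrable.
  have i₁ : IntegrableOn f.f₁ (D₁ ×ˢ D₂) := hf₁.integrable hp
  have i₂ : IntegrableOn f.f₂ (D₁ ×ˢ D₂) := hf₂.integrable hp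
  have i₃ : IntegrableOn (DbarProduct.scriptD (D₁ ×ˢ D₂) f) (D₁ ×ˢ D₂) := hSp.integrable hp
  -- Closedness makes both terms of the average defining `𝒟(f)` equal, so each of them is `𝒟(f)`.
  have w₂ : ∀ φ, DbarProduct.IsTestFunction (D₁ ×ˢ D₂) φ →
      ∫ z in D₁ ×ˢ D₂, f.f₂ z * DbarProduct.dbar₁ φ z
        = -∫ z in D₁ ×ˢ D₂, DbarProduct.scriptD (D₁ ×ˢ D₂) f z * φ z := fun φ hφ => by
    rw [hS.2.2 φ hφ, hcl.2 φ hφ]; ring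
  have w₁ : ∀ φ, DbarProduct.IsTestFunction (D₁ ×ˢ D₂) φ →
      ∫ z in D₁ ×ˢ D₂, f.f₁ z * DbarProduct.dbar₂ φ z
        = -∫ z in D₁ ×ˢ D₂, DbarProduct.scriptD (D₁ ×ˢ D₂) f z * φ z := fun φ hφ => by
    rw [hS.2.2 φ hφ, hcl.2 φ hφ]; ring
  have j₁ := i₁
  have j₂ := i₂
  have j₃ := i₃
  rw [IntegrableOn, hvol] at j₁ j₂ j₃
  have hle : eLpNorm (DbarProduct.solT D₁ D₂ f) p (volume.restrict (D₁ ×ˢ D₂)) ≤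
      (A + A * A) * DbarProduct.normB p (D₁ ×ˢ D₂) f := by
    rw [DbarProduct.solT_eq_cauchySol, DbarProduct.normB, hvol]
    exact DbarProduct.eLpNorm_cauchySol_le hA hB hA' hp hp' j₁.1 j₂.1 j₃
  have hnB : DbarProduct.normB p (D₁ ×ˢ D₂) f < ⊤ :=
    ENNReal.add_lt_top.2 ⟨ENNReal.add_lt_top.2 ⟨hf₁.2, hf₂.2⟩, hSp.2⟩
  have hmem : MemLp (DbarProduct.solT D₁ D₂ f) p (volume.restrict (D₁ ×ˢ D₂)) := by
    refine ⟨?_, hle.trans_lt (ENNReal.mul_lt_top hAA.lt_top hnB)⟩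
    rw [DbarProduct.solT_eq_cauchySol, hvol]
    exact DbarProduct.aestronglyMeasurable_cauchySol hA hB hA' j₁.1 j₂.1 j₃
  refine ⟨?_, fun f' h₁ h₂ => ?_, ⟨?_, hcl.1, fun φ hφ => ⟨?_, ?_⟩⟩, hmem, hle.trans ?_⟩
  · rw [hvol]
    filter_upwards [DbarProduct.integrable_cauchyFst_ae hA hA' j₁,
      DbarProduct.integrable_cauchySnd_ae hB hA' j₂,
      DbarProduct.integrable_double_cauchy_ae hA hB hA' j₃] with z h₁ h₂ h₃
    refine ⟨h₂, h₁, ?_⟩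
    rw [IntegrableOn, hvol]
    exact h₃
  · have hf' : f'.LocIntegrableOn (D₁ ×ˢ D₂) :=
      ⟨IntegrableOn.locallyIntegrableOn (Integrable.congr i₁ h₁.symm),
        IntegrableOn.locallyIntegrableOn (Integrable.congr i₂ h₂.symm)⟩
    have hD := DbarProduct.scriptD_congr hcl.1 hf' h₁ h₂
    rw [hvol] at h₁ h₂
    rw [DbarProduct.solT_eq_cauchySol, DbarProduct.solT_eq_cauchySol, hD, hvol]
    filter_upwards [DbarProduct.cauchyFst_congr_ae h₁, DbarProduct.cauchySnd_congr_ae h₂]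
      with z e₁ e₂
    rw [DbarProduct.cauchySol, DbarProduct.cauchySol, e₁, e₂]
  · exact IntegrableOn.locallyIntegrableOn (hmem.integrable hp)
  · rw [DbarProduct.solT_eq_cauchySol]
    exact DbarProduct.integral_cauchySol_mul_dbar₁ hA hB hA' DbarProduct.isOpen_puncturedDisc
      i₁ i₂ i₃ w₂ hφ
  · rw [DbarProduct.solT_eq_cauchySol]
    exact DbarProduct.integral_cauchySol_mul_dbar₂ hA hB hA' DbarProduct.isOpen_disc
      i₁ i₂ i₃ w₁ hφ
  · gcongr
    rw [ENNReal.ofReal_add ENNReal.toReal_nonneg zero_le_one, ENNReal.ofReal_toReal hAA]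
    exact le_self_add
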